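/- **Model.** Finitely many DAG tasks $\tau_i$ share finitely many resources $\ell_q$. Task $\tau_i$ has a finite directed acyclic graph with a unique head and a unique tail, a worst-case execution time $c(v)\ge 0$ for each vertex $v$, a period $T_i$ (consecutive releases are at least $T_i$ apart) and a relative deadline $0<D_i\le T_i$. Put $\mathcal C_i=\sum_v c(v)$ and let $\mathcal L_i$ be the largest total WCET of a path from head to tail. One job of $\tau_i$ accesses $\ell_q$ at most $N_{i,q}$ times, each time for at most $L_{i,q}$ time units (this time is part of the WCET); $\Theta_i=\{\ell_q: N_{i,q}>0\}$. All tasks have density $\mathcal C_i/D_i>1$. Of $m$ processors, pairwise disjoint sets are assigned to the tasks; each task runs on its own processors only, under a work-conserving scheduler. Resources are protected by non-nested spin locks: a vertex that requests a lock held by another vertex spins until it obtains the lock; spinning and lock holding are non-preemptive; waiting requests are served in an arbitrary order (unordered). A job has response time $f(J)-r(J)$ ($r$ release, $f$ finish, $f=\infty$ if it never finishes), $R_i$ is the supremum over the jobs of $\tau_i$, and $\tau_i$ is schedulable if $R_i\le D_i$. Let $$\eta_{i,j}^q=\begin{cases}\lceil (D_i+D_j)/T_j\rceil & \text{if } \ell_q\in\Theta_i\cap\Theta_j,\\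 0&\text{otherwise,}\end{cases}$$ $$S_i = D_i-\Big(\sum_{j\ne i}\sum_{\ell_q\in\Theta_i}\eta_{i,j}^q N_{j,q}L_{j,q}+\mathcal L_i+\sum_{\ell_q\in\Theta_i}N_{i,q}L_{i,q}\Big),\qquad m_i=\left\lceil\frac{\mathcal C_i-\big(\mathcal L_i+\sum_{\ell_q\in\Theta_i}N_{i,q}L_{i,q}\big)}{S_i}\right\rceil .$$ **Statement.** 1. If $S_i>0$ and $\tau_i$ is assigned exactly $m_i$ processors, then $\tau_i$ is schedulable in every run of the system in which each other task $\tau_j$ either is schedulable, or also has $S_j>0$ and is assigned exactly $m_j$ processors. 2. Consider the algorithm that goes through the tasks in any order and, for each $\tau_i$, returns "unschedulable" if $S_i\le 0$ or if fewer than $m_i$ processors are still available, and otherwise assigns $m_i$ processors to $\tau_i$; at the end it returns "schedulable". It returns "schedulable" if and only if $S_i>0$ for all $i$ and $\sum_i m_i\le m$, and the numbers of processors assigned are then the $m_i$. 3. If the algorithm returns "schedulable", then pairwise disjoint sets of processors with the assigned cardinalities exist, and for every such choice every task is schedulable in every run of the system. -/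

import Mathlib

open MeasureTheory

universe u v w

noncomputable section

/-- A DAG task with its timing parameters and its resource-access parameters. -/
structure DAGTask (Θ : Type v) where
  /-- The vertices of the DAG. -/
  V : Type u
  [finV : Fintype V]
  /-- `edge a b`: `a` is a predecessor of `b`. -/
  edge : V → V → Prop
  acyclic : ∀ a, ¬ Relation.TransGen edge a a
  /-- The unique vertex without predecessors. -/
  head : V
  /-- The unique vertex without successors. -/
  tail : V
  head_iff : ∀ a, (∀ b, ¬ edge b a) ↔ a = head
  tail_iff : ∀ a, (∀ b, ¬ edge a b) ↔ a = tail
  /-- Worst-case execution time of a vertex (lock-holding time included, spinning excluded). -/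
  wcet : V → ℝ
  wcet_nonneg : ∀ a, 0 ≤ wcet a
  /-- Period (minimal distance of two consecutive releases). -/
  T : ℝ
  /-- Relative deadline. -/
  D : ℝ
  D_pos : 0 < D
  D_le_T : D ≤ T
  /-- Worst-case number of accesses to each resource by one job. -/
  N : Θ → ℕ
  /-- Worst-case duration of a single access to each resource. -/
  L : Θ → ℝ
  L_nonneg : ∀ q, 0 ≤ L q

attribute [instance] DAGTask.finV

namespace DAGTask

variable {Θ : Type v}

/-- Total worst-case execution time `C`. -/
def totalWork (τ : DAGTask.{u, v} Θ) : ℝ := ∑ a, τ.wcet a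

/-- Complete paths: from the head to the tail along edges. -/
def IsCompletePath (τ : DAGTask.{u, v} Θ) (π : List τ.V) : Prop :=
  π.IsChain τ.edge ∧ π.head? = some τ.head ∧ π.getLast? = some τ.tail

/-- Length of a path. -/
def len (τ : DAGTask.{u, v} Θ) (π : List τ.V) : ℝ := (π.map τ.wcet).sum

/-- The longest length among the complete paths. There are finitely many of them and at least
one, so this supremum is a maximum. -/
def longest (τ : DAGTask.{u, v} Θ) : ℝ := sSup {x | ∃ π, τ.IsCompletePath π ∧ x = τ.len π}

/-- Density `C / D`. -/
def density (τ : DAGTask.{u, v} Θ) : ℝ := τ.totalWork / τ.D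

/-- The task accesses the resource `q`. -/
def Accesses (τ : DAGTask.{u, v} Θ) (q : Θ) : Prop := 0 < τ.N q

open Classical in
/-- The set of resources accessed by the task. -/
def resources [Fintype Θ] (τ : DAGTask.{u, v} Θ) : Finset Θ := {q | τ.Accesses q}

end DAGTask

section Analysis

variable {ι : Type w} {Θ : Type v}

open Classical in
/-- `η i j q`: the bound on the number of jobs of task `j` contending for `q` with a job
of task `i`. -/
def eta (τ : ι → DAGTask.{u, v} Θ) (i j : ι) (q : Θ) : ℕ :=
  if (τ i).Accesses q ∧ (τ j).Accesses q then ⌈((τ i).D + (τ j).D) / (τ j).T⌉₊ else 0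

variable [Fintype Θ]

/-- The intra-task term `∑ N_{i,q} L_{i,q}` over the resources accessed by task `i`. -/
def intraTerm (τ : ι → DAGTask.{u, v} Θ) (i : ι) : ℝ :=
  ∑ q ∈ (τ i).resources, ((τ i).N q : ℝ) * (τ i).L q

variable [Fintype ι] [DecidableEq ι]

/-- The inter-task blocking term of task `i`. -/
def interTerm (τ : ι → DAGTask.{u, v} Θ) (i : ι) : ℝ :=
  ∑ j ∈ Finset.univ.erase i, ∑ q ∈ (τ i).resources,
    (eta τ i j q : ℝ) * ((τ j).N q : ℝ) * (τ j).L q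

/-- The slack `D_i - (inter-task term + longest path + intra-task term)`. -/
def slack (τ : ι → DAGTask.{u, v} Θ) (i : ι) : ℝ :=
  (τ i).D - (interTerm τ i + (τ i).longest + intraTerm τ i)

/-- The number of processors `m_i`. -/
def procCount (τ : ι → DAGTask.{u, v} Θ) (i : ι) : ℕ :=
  ⌈((τ i).totalWork - ((τ i).longest + intraTerm τ i)) / slack τ i⌉₊

open Classical in
/-- The processor partitioning algorithm for unordered locks: the arguments are the tasks still to
be treated, the number of processors still available, and the numbers of processors assigned so
far. The answer `none` is "unschedulable"; `some A` is "schedulable", with the numbers of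
processors `A`. -/
def partitionAlg (τ : ι → DAGTask.{u, v} Θ) : List ι → ℕ → (ι → ℕ) → Option (ι → ℕ)
  | [], _, A => some A
  | i :: ts, avail, A =>
      if 0 < slack τ i then
        if avail < procCount τ i then none
        else partitionAlg τ ts (avail - procCount τ i) (Function.update A i (procCount τ i))
      else none

end Analysis

/-- A vertex of a job: the task, the index of the job of that task, the vertex. -/
structure JobVertex {ι : Type w} {Θ : Type v} (τ : ι → DAGTask.{u, v} Θ) where
  task : ι
  job : ℕ
  vertex : (τ task).V

/-- A code segment accessing `res`: it starts when the vertex has executed for `start` time units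
and it takes `dur` time units of execution. -/
structure LockSection (Θ : Type v) where
  res : Θ
  start : ℝ
  dur : ℝ

/-- The data of a run of the system on `m` processors over the whole time line. -/
structure Run {ι : Type w} {Θ : Type v} (τ : ι → DAGTask.{u, v} Θ) (m : ℕ) where
  /-- Release time of each job. -/
  release : ι → ℕ → ℝ
  /-- Actual execution demand of each vertex of each job. -/
  exec : JobVertex τ → ℝ
  /-- The lock-protected code segments of each vertex of each job. -/
  sections : JobVertex τ → List (LockSection Θ)
  /-- What each processor is busy with at each time (`none`: idle). -/
  proc : Fin m → ℝ → Option (JobVertex τ)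
  /-- Who holds each lock at each time (`none`: the lock is free). -/
  holder : Θ → ℝ → Option (JobVertex τ)
  /-- Amount of execution that a vertex has received before a time. -/
  progress : JobVertex τ → ℝ → ℝ

namespace Run

variable {ι : Type w} {Θ : Type v} {τ : ι → DAGTask.{u, v} Θ} {m : ℕ}

/-- Some processor is busy with `x` at time `t`. -/
def Busy (R : Run τ m) (x : JobVertex τ) (t : ℝ) : Prop := ∃ p, R.proc p t = some x

/-- The execution of `x` has reached the code segment `s` (its first instant included) and has
not yet completed it. -/
def InSection (R : Run τ m) (x : JobVertex τ) (s : LockSection Θ) (t : ℝ) : Prop :=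
  s ∈ R.sections x ∧ s.start ≤ R.progress x t ∧ R.progress x t < s.start + s.dur

/-- `x` is spinning for `q`: it occupies a processor, is at a segment accessing `q`, and does not
hold the lock. -/
def Spinning (R : Run τ m) (x : JobVertex τ) (q : Θ) (t : ℝ) : Prop :=
  R.Busy x t ∧ (∃ s, R.InSection x s t ∧ s.res = q) ∧ R.holder q t ≠ some x

/-- `x` is executing: it occupies a processor and does not spin. -/
def Executing (R : Run τ m) (x : JobVertex τ) (t : ℝ) : Prop :=
  R.Busy x t ∧ ∀ q, ¬ R.Spinning x q t

/-- `x` has received its whole execution demand. -/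
def Done (R : Run τ m) (x : JobVertex τ) (t : ℝ) : Prop := R.exec x ≤ R.progress x t

/-- `x` is eligible: its job is released and its predecessors are finished. The condition is on
direct and indirect predecessors, because vertices without any execution demand (such as dummy
vertices) are `Done` from the start. -/
def Eligible (R : Run τ m) (x : JobVertex τ) (t : ℝ) : Prop :=
  R.release x.task x.job ≤ t ∧
    ∀ a, Relation.TransGen (τ x.task).edge a x.vertex → R.Done ⟨x.task, x.job, a⟩ t

/-- The behaviours that the model admits when task `i` is given the processors `P i`, with
spin locks served in an arbitrary order. -/
structure Legal [DecidableEq Θ] (R : Run τ m) (P : ι → Finset (Fin m)) : Prop where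
  release_sep : ∀ i k, R.release i k + (τ i).T ≤ R.release i (k + 1)
  exec_nonneg : ∀ x, 0 ≤ R.exec x
  exec_le_wcet : ∀ x, R.exec x ≤ (τ x.task).wcet x.vertex
  /-- Each access takes a positive time, at most `L`, and lies within the execution. -/
  section_bounds : ∀ x, ∀ s ∈ R.sections x,
    0 ≤ s.start ∧ 0 < s.dur ∧ s.dur ≤ (τ x.task).L s.res ∧ s.start + s.dur ≤ R.exec x
  /-- Locks are not nested. -/
  section_disjoint : ∀ x, (R.sections x).Pairwise (fun s s' => s.start + s.dur ≤ s'.start)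
  /-- Each job accesses `q` at most `N` times. -/
  access_count : ∀ i k q,
    ∑ a, ((R.sections ⟨i, k, a⟩).filter (fun s => s.res = q)).length ≤ (τ i).N q
  measurable_proc : ∀ p x, MeasurableSet {t | R.proc p t = some x}
  measurable_holder : ∀ q x, MeasurableSet {t | R.holder q t = some x}
  progress_eq : ∀ x t, R.progress x t =
    (volume {s | R.release x.task x.job ≤ s ∧ s < t ∧ R.Executing x s}).toReal
  /-- Each task runs on its own processors only. -/
  proc_mem : ∀ p t x, R.proc p t = some x → p ∈ P x.task
  /-- A vertex occupies at most one processor at a time. -/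
  proc_inj : ∀ p p' t x, R.proc p t = some x → R.proc p' t = some x → p = p'
  /-- Only eligible unfinished vertices run. -/
  busy_eligible : ∀ x t, R.Busy x t → R.Eligible x t ∧ ¬ R.Done x t
  /-- Work conservation: no processor of a task is idle while an eligible unfinished vertex of
  this task is waiting for a processor. -/
  work_conserving : ∀ x t, R.Eligible x t → ¬ R.Done x t → ¬ R.Busy x t →
    ∀ p ∈ P x.task, R.proc p t ≠ none
  /-- A lock is held only by a running vertex that is at a segment accessing its resource. -/
  holder_spec : ∀ q t x, R.holder q t = some x →
    R.Busy x t ∧ ∃ s, R.InSection x s t ∧ s.res = q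
  /-- A lock that has been obtained is kept until the end of the segment. -/
  holder_keep : ∀ x s t t', R.InSection x s t → R.holder s.res t = some x → t ≤ t' →
    R.InSection x s t' → R.holder s.res t' = some x
  /-- Spinning and holding are non-preemptive. -/
  nonpreemptive : ∀ x s t t', R.InSection x s t → R.Busy x t → t ≤ t' →
    R.InSection x s t' → R.Busy x t'
  /-- A vertex spins only while the lock is held. -/
  spin_held : ∀ x q t, R.Spinning x q t → R.holder q t ≠ none

/-- Finish time `f(J)` of the `k`-th job of task `i` (`⊤` if it never finishes). -/
def finish (R : Run τ m) (i : ι) (k : ℕ) : EReal :=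
  sInf (Real.toEReal '' {t | R.release i k ≤ t ∧ ∀ a, R.Done ⟨i, k, a⟩ t})

/-- Response time `R(J) = f(J) - r(J)`. -/
def responseTime (R : Run τ m) (i : ι) (k : ℕ) : EReal :=
  R.finish i k - (R.release i k : EReal)

/-- Worst-case response time of task `i` over all its jobs. -/
def wcrt (R : Run τ m) (i : ι) : EReal := ⨆ k, R.responseTime i k

/-- Task `i` is schedulable in the run: `R_i ≤ D_i`. -/
def Schedulable (R : Run τ m) (i : ι) : Prop := R.wcrt i ≤ ((τ i).D : EReal)

end Run

end

/-! Suppose a deadline is missed. Releases of a task are separated, so some missing job has the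
earliest absolute deadline d; let it belong to task i, with window [r, d), d = r + D_i. All jobs
with strictly earlier deadlines meet them. This choice removes the circularity of mutual blocking,
and `Legal.done_deadline` refutes it.

Cover the window by B, where another task holds a lock of a resource in Θ_i; Y, outside B, where the
job itself holds such a lock or executes a vertex of a critical path; and the rest Z. A job of task
j that holds a lock in the window is released in (r - D_j, d), which leaves at most ⌈(D_i +
D_j)/T_j⌉ jobs and bounds |B| by the inter-task term. Also |Y| ≤ Λ, where Λ is `longest` plus
`intraTerm`. On Z no vertex of the job spins, and the critical path supplies an eligible vertex that
is not running, so work conservation makes all m_i processors execute the job.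

The executed work is therefore at least |Y| + m_i |Z|, yet less than C_i. From D_i ≤ |B| + |Y| + |Z|
follows |Z| ≥ S_i + (Λ - |Y|). Since m_i ≥ 1, the work is at least m_i S_i + Λ ≥ C_i, a
contradiction. -/

namespace Run

variable {ι : Type w} {Θ : Type v} {τ : ι → DAGTask.{u, v} Θ} {m : ℕ} [DecidableEq Θ]
  {R : Run τ m} {P : ι → Finset (Fin m)}

/-! ### Progress of a vertex: continuity and measurability -/

namespace Legal

lemma release_le_of_executing (h : R.Legal P) {x : JobVertex τ} {t : ℝ} (hx : R.Executing x t) :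
    R.release x.task x.job ≤ t :=
  (h.busy_eligible x t hx.1).1.1

lemma progress_eq_volume_real (h : R.Legal P) (x : JobVertex τ) (t : ℝ) :
    R.progress x t = volume.real ({s | R.Executing x s} ∩ Set.Iio t) := by
  rw [h.progress_eq, measureReal_def]
  congr 2
  ext s
  simp only [Set.mem_ofPred_eq, Set.mem_inter_iff, Set.mem_Iio]
  exact ⟨fun ⟨_, a, b⟩ => ⟨b, a⟩, fun ⟨b, a⟩ => ⟨h.release_le_of_executing b, a, b⟩⟩

lemma volume_executing_ne_top (h : R.Legal P) (x : JobVertex τ) (t : ℝ) :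
    volume ({s | R.Executing x s} ∩ Set.Iio t) ≠ ⊤ := by
  refine ne_top_of_le_ne_top ?_ (measure_mono (t := Set.Ico (R.release x.task x.job) t) ?_)
  · rw [Real.volume_Ico]; exact ENNReal.ofReal_ne_top
  · rintro s ⟨hs, hst⟩
    exact ⟨h.release_le_of_executing hs, hst⟩

lemma progress_mono (h : R.Legal P) (x : JobVertex τ) : Monotone (R.progress x) := by
  intro t t' htt
  rw [h.progress_eq_volume_real, h.progress_eq_volume_real]
  exact measureReal_mono (Set.inter_subset_inter_right _ (Set.Iio_subset_Iio htt))
    (h.volume_executing_ne_top x t')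

/-- Subadditivity avoids measurability of the executing set, which is itself derived later from the
continuity of progress that rests on this bound. -/
lemma progress_le_add (h : R.Legal P) (x : JobVertex τ) {t t' : ℝ} (htt : t ≤ t') :
    R.progress x t' ≤ R.progress x t + volume.real ({s | R.Executing x s} ∩ Set.Ico t t') := by
  rw [h.progress_eq_volume_real, h.progress_eq_volume_real]
  rw [← Set.Iio_union_Ico_eq_Iio htt, Set.inter_union_distrib_left]
  exact measureReal_union_le _ _

lemma progress_le_add_sub (h : R.Legal P) (x : JobVertex τ) {t t' : ℝ} (htt : t ≤ t') :
    R.progress x t' ≤ R.progress x t + (t' - t) := by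
  refine (h.progress_le_add x htt).trans ?_
  have : volume.real ({s | R.Executing x s} ∩ Set.Ico t t') ≤ volume.real (Set.Ico t t') :=
    measureReal_mono Set.inter_subset_right (by simp)
  rw [Real.volume_real_Ico_of_le htt] at this
  linarith

lemma continuous_progress (h : R.Legal P) (x : JobVertex τ) : Continuous (R.progress x) := by
  refine (LipschitzWith.of_le_add_mul 1 fun t t' => ?_).continuous
  rcases le_total t t' with htt | htt
  · have := h.progress_mono x htt
    have := dist_nonneg (x := t) (y := t')
    simp only [NNReal.coe_one, one_mul]
    linarith
  · have := h.progress_le_add_sub x htt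
    rw [Real.dist_eq, abs_of_nonneg (sub_nonneg.2 htt), NNReal.coe_one, one_mul]
    exact this

lemma progress_release (h : R.Legal P) (x : JobVertex τ) :
    R.progress x (R.release x.task x.job) = 0 := by
  have hempty : {s | R.Executing x s} ∩ Set.Iio (R.release x.task x.job) = ∅ :=
    Set.eq_empty_of_forall_notMem fun s hs =>
      absurd (h.release_le_of_executing hs.1) (not_le.2 hs.2)
  rw [h.progress_eq_volume_real, hempty, measureReal_empty]

lemma done_mono (h : R.Legal P) {x : JobVertex τ} {t t' : ℝ} (htt : t ≤ t') (ht : R.Done x t) :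
    R.Done x t' :=
  le_trans ht (h.progress_mono x htt)

/-- A vertex never receives more than its execution demand. -/
lemma progress_le_exec (h : R.Legal P) (x : JobVertex τ) (t : ℝ) :
    R.progress x t ≤ R.exec x := by
  by_contra! hlt
  have h0 := h.exec_nonneg x
  have hr : R.release x.task x.job ≤ t := by
    by_contra! hr
    have := h.progress_mono x hr.le
    rw [h.progress_release] at this
    linarith
  -- At some moment the progress equals the demand exactly; from then on the vertex is done, hence
  -- never busy, and progress stops.
  obtain ⟨t₁, ⟨-, ht₁⟩, he⟩ := intermediate_value_Icc hr (h.continuous_progress x).continuousOn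
    (show R.exec x ∈ Set.Icc _ _ from ⟨by rw [h.progress_release]; exact h0, hlt.le⟩)
  have hempty : {s | R.Executing x s} ∩ Set.Ico t₁ t = ∅ := by
    ext s
    simp only [Set.mem_inter_iff, Set.mem_ofPred_eq, Set.mem_Ico, Set.mem_empty_iff_false,
      iff_false, not_and]
    intro hs h1 _
    exact (h.busy_eligible x s hs.1).2 (h.done_mono h1 he.ge)
  have := h.progress_le_add x ht₁
  rw [hempty, measureReal_empty] at this
  linarith

lemma measurableSet_busy (h : R.Legal P) (x : JobVertex τ) :
    MeasurableSet {t | R.Busy x t} := by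
  simp only [Busy, Set.ofPred_exists]
  exact MeasurableSet.iUnion fun p => h.measurable_proc p x

lemma measurableSet_inSection (h : R.Legal P) (x : JobVertex τ) (s : LockSection Θ) :
    MeasurableSet {t | R.InSection x s t} := by
  have hm := (h.continuous_progress x).measurable
  by_cases hs : s ∈ R.sections x
  · have : {t | R.InSection x s t} = R.progress x ⁻¹' Set.Ico s.start (s.start + s.dur) := by
      ext t; simp [InSection, hs]
    rw [this]
    exact hm measurableSet_Ico
  · have : {t | R.InSection x s t} = ∅ := by
      ext t; simp [InSection, hs]
    rw [this]
    exact MeasurableSet.empty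

lemma measurableSet_spinning (h : R.Legal P) (x : JobVertex τ) (q : Θ) :
    MeasurableSet {t | R.Spinning x q t} := by
  refine (h.measurableSet_busy x).inter (MeasurableSet.inter ?_ (h.measurable_holder q x).compl)
  have : {t | ∃ s, R.InSection x s t ∧ s.res = q} =
      ⋃ s ∈ {s | s ∈ R.sections x ∧ s.res = q}, {t | R.InSection x s t} := by
    ext t
    simp only [Set.mem_ofPred_eq, Set.mem_iUnion, exists_prop]
    constructor
    · rintro ⟨s, hs, hq⟩; exact ⟨s, ⟨hs.1, hq⟩, hs⟩
    · rintro ⟨s, ⟨-, hq⟩, hs⟩; exact ⟨s, hs, hq⟩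
  change MeasurableSet {t | ∃ s, R.InSection x s t ∧ s.res = q}
  rw [this]
  exact Set.Finite.measurableSet_biUnion
    ((R.sections x).finite_toSet.subset fun s hs => hs.1) fun s _ => h.measurableSet_inSection x s

lemma measurableSet_executing [Fintype Θ] (h : R.Legal P) (x : JobVertex τ) :
    MeasurableSet {t | R.Executing x t} := by
  refine (h.measurableSet_busy x).inter ?_
  change MeasurableSet {t | ∀ q, ¬ R.Spinning x q t}
  rw [Set.ofPred_forall]
  exact MeasurableSet.iInter fun q => (h.measurableSet_spinning x q).compl

lemma volume_real_executing_Ico [Fintype Θ] (h : R.Legal P) (x : JobVertex τ) {t t' : ℝ}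
    (htt : t ≤ t') :
    volume.real ({s | R.Executing x s} ∩ Set.Ico t t') = R.progress x t' - R.progress x t := by
  rw [h.progress_eq_volume_real, h.progress_eq_volume_real, ← Set.Iio_union_Ico_eq_Iio htt,
    Set.inter_union_distrib_left, measureReal_union _
      ((h.measurableSet_executing x).inter measurableSet_Ico) (h.volume_executing_ne_top x t)
      (ne_top_of_le_ne_top (h.volume_executing_ne_top x t')
        (measure_mono (Set.inter_subset_inter_right _ fun s hs => hs.2)))]
  · ring
  · refine Set.disjoint_left.2 fun s hs hs' => ?_
    exact absurd hs'.2.1 (not_le.2 hs.2)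

/-- While the progress of a vertex lies in `[a, b)`, the vertex executes for at most `b - a`. -/
lemma volume_real_executing_progress_le [Fintype Θ] (h : R.Legal P) (x : JobVertex τ) {a b : ℝ}
    (hab : a ≤ b) (r d : ℝ) :
    (volume.restrict (Set.Ico r d)).real
      {t | R.Executing x t ∧ a ≤ R.progress x t ∧ R.progress x t < b} ≤ b - a := by
  have hc := h.continuous_progress x
  have hmeas : MeasurableSet {t | R.Executing x t ∧ a ≤ R.progress x t ∧ R.progress x t < b} :=
    (h.measurableSet_executing x).inter (hc.measurable (measurableSet_Ico (a := a) (b := b)))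
  rw [measureReal_restrict_apply hmeas]
  set A := {t | R.Executing x t ∧ a ≤ R.progress x t ∧ R.progress x t < b} ∩ Set.Ico r d with hA
  rcases A.eq_empty_or_nonempty with he | hne
  · rw [he, measureReal_empty]; linarith
  have hbb : BddBelow A := ⟨r, fun s hs => hs.2.1⟩
  have hba : BddAbove A := ⟨d, fun s hs => hs.2.2.le⟩
  have hle : sInf A ≤ sSup A := csInf_le_csSup hne hbb hba
  -- By continuity the bounds pass to the two ends of `A`; the execution in between is a difference
  -- of progress, and the endpoint `sSup A` is null.
  have h0 : a ≤ R.progress x (sInf A) := by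
    have hcl : IsClosed {t | a ≤ R.progress x t} := isClosed_le continuous_const hc
    exact hcl.closure_subset_iff.2 (fun s hs => hs.1.2.1) (csInf_mem_closure hne hbb)
  have h1 : R.progress x (sSup A) ≤ b := by
    have hcl : IsClosed {t | R.progress x t ≤ b} := isClosed_le hc continuous_const
    exact hcl.closure_subset_iff.2 (fun s hs => hs.1.2.2.le) (csSup_mem_closure hne hba)
  have hsub : A ⊆ ({s | R.Executing x s} ∩ Set.Ico (sInf A) (sSup A)) ∪ {sSup A} := by
    intro s hs
    rcases (le_csSup hba hs).eq_or_lt with hs' | hs'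
    · exact Or.inr hs'
    · exact Or.inl ⟨hs.1.1, csInf_le hbb hs, hs'⟩
  have hfin : volume (({s | R.Executing x s} ∩ Set.Ico (sInf A) (sSup A)) ∪ {sSup A}) ≠ ⊤ :=
    ne_top_of_le_ne_top (b := volume (Set.Icc (sInf A) (sSup A))) (by simp)
      (measure_mono (Set.union_subset (fun s hs => Set.Ico_subset_Icc_self hs.2)
        (Set.singleton_subset_iff.2 ⟨hle, le_rfl⟩)))
  calc volume.real A ≤ _ := measureReal_mono hsub hfin
    _ ≤ _ := measureReal_union_le _ _
    _ ≤ b - a := by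
      rw [h.volume_real_executing_Ico x hle, measureReal_def, Real.volume_singleton]
      simp only [ENNReal.toReal_zero]
      linarith

end Legal
end Run

/-! ### Lock-holding times -/

namespace Run

variable {ι : Type w} {Θ : Type v} {τ : ι → DAGTask.{u, v} Θ} {m : ℕ} [DecidableEq Θ]
  {R : Run τ m} {P : ι → Finset (Fin m)}

namespace Legal

lemma inSection_unique (h : R.Legal P) {x : JobVertex τ} {s s' : LockSection Θ} {t : ℝ}
    (hs : R.InSection x s t) (hs' : R.InSection x s' t) : s = s' := by
  by_contra hne
  have hp : (R.sections x).Pairwise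
      (fun s s' => s.start + s.dur ≤ s'.start ∨ s'.start + s'.dur ≤ s.start) :=
    (h.section_disjoint x).imp fun hab => Or.inl hab
  obtain ⟨m1, a1, b1⟩ := hs
  obtain ⟨m2, a2, b2⟩ := hs'
  have : Std.Symm (fun s s' : LockSection Θ =>
    s.start + s.dur ≤ s'.start ∨ s'.start + s'.dur ≤ s.start) := ⟨fun _ _ => Or.symm⟩
  rcases hp.forall m1 m2 hne with h1 | h1 <;> linarith

/-- A vertex that holds a lock executes. -/
lemma executing_of_holder (h : R.Legal P) {x : JobVertex τ} {q : Θ} {t : ℝ}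
    (hx : R.holder q t = some x) : R.Executing x t := by
  obtain ⟨hb, s, hs, hq⟩ := h.holder_spec q t x hx
  refine ⟨hb, ?_⟩
  rintro q' ⟨-, ⟨s', hs', hq'⟩, hne⟩
  have := h.inSection_unique hs hs'
  subst this
  exact hne (hq' ▸ hq ▸ hx)

/-- A job accesses only the resources that its task accesses. -/
lemma accesses_of_mem_sections (h : R.Legal P) {x : JobVertex τ} {s : LockSection Θ}
    (hs : s ∈ R.sections x) : (τ x.task).Accesses s.res := by
  have h1 := h.access_count x.task x.job s.res
  have h2 : ((R.sections x).filter (fun s' => s'.res = s.res)).length ≤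
      ∑ a, ((R.sections ⟨x.task, x.job, a⟩).filter (fun s' => s'.res = s.res)).length :=
    Finset.single_le_sum
      (f := fun a => ((R.sections ⟨x.task, x.job, a⟩).filter (fun s' => s'.res = s.res)).length)
      (fun _ _ => Nat.zero_le _) (Finset.mem_univ x.vertex)
  have h3 : 0 < ((R.sections x).filter (fun s' => s'.res = s.res)).length :=
    List.length_pos_of_mem (List.mem_filter.2 ⟨hs, by simp⟩)
  exact h3.trans_le (h2.trans h1)

variable [Fintype Θ]

/-- A holder executes inside one of its segments for `q`, and each such segment absorbs at most `L`
units of execution. -/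
lemma volume_real_held_by_vertex_le (h : R.Legal P) (x : JobVertex τ) (q : Θ) (r d : ℝ) :
    (volume.restrict (Set.Ico r d)).real {t | R.holder q t = some x} ≤
      ((R.sections x).filter (fun s => s.res = q)).length * (τ x.task).L q := by
  classical
  set F := ((R.sections x).filter (fun s => s.res = q)).toFinset with hF
  have hsub : {t | R.holder q t = some x} ⊆ ⋃ s ∈ F,
      {t | R.Executing x t ∧ s.start ≤ R.progress x t ∧ R.progress x t < s.start + s.dur} := by
    intro t ht
    obtain ⟨-, s, hs, hq⟩ := h.holder_spec q t x ht
    simp only [Set.mem_iUnion]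
    exact ⟨s, by simp [hF, hs.1, hq], h.executing_of_holder ht, hs.2⟩
  have hcard : (F.card : ℝ) ≤ ((R.sections x).filter (fun s => s.res = q)).length :=
    Nat.cast_le.2 (List.toFinset_card_le _)
  calc _ ≤ _ := measureReal_mono hsub (measure_ne_top _ _)
    _ ≤ _ := measureReal_biUnion_finset_le _ _
    _ ≤ ∑ s ∈ F, (τ x.task).L q := by
      refine Finset.sum_le_sum fun s hs => ?_
      have hs' : s ∈ R.sections x ∧ s.res = q := by simpa [hF] using hs
      obtain ⟨-, h1, h2, -⟩ := h.section_bounds x s hs'.1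
      refine (h.volume_real_executing_progress_le x (by linarith) r d).trans ?_
      rw [hs'.2] at h2
      linarith
    _ = F.card * (τ x.task).L q := by rw [Finset.sum_const, nsmul_eq_mul]
    _ ≤ _ := mul_le_mul_of_nonneg_right hcard ((τ x.task).L_nonneg q)

/-- One job of task `j` holds the lock of `q` for at most `N * L` time units. -/
lemma volume_real_held_by_job_le (h : R.Legal P) (j : ι) (k : ℕ) (q : Θ) (r d : ℝ) :
    (volume.restrict (Set.Ico r d)).real {t | ∃ a, R.holder q t = some ⟨j, k, a⟩} ≤
      (τ j).N q * (τ j).L q := by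
  have hU : {t | ∃ a, R.holder q t = some ⟨j, k, a⟩} =
      ⋃ a ∈ (Finset.univ : Finset (τ j).V), {t | R.holder q t = some ⟨j, k, a⟩} := by
    ext t; simp
  rw [hU]
  calc _ ≤ _ := measureReal_biUnion_finset_le _ _
    _ ≤ _ := Finset.sum_le_sum fun a _ => h.volume_real_held_by_vertex_le ⟨j, k, a⟩ q r d
    _ = (∑ a, ((R.sections ⟨j, k, a⟩).filter (fun s => s.res = q)).length : ℝ) * (τ j).L q := by
      rw [Finset.sum_mul]
    _ ≤ _ := by
      refine mul_le_mul_of_nonneg_right ?_ ((τ j).L_nonneg q)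
      exact_mod_cast h.access_count j k q

end Legal
end Run

/-! ### Counting the jobs that can interfere with a window -/

lemma DAGTask.T_pos {Θ : Type v} (τ : DAGTask.{u, v} Θ) : 0 < τ.T := τ.D_pos.trans_le τ.D_le_T

lemma add_mul_le_of_forall_add_le_succ {f : ℕ → ℝ} {T : ℝ} (hf : ∀ k, f k + T ≤ f (k + 1))
    (k n : ℕ) : f k + n * T ≤ f (k + n) := by
  induction n with
  | zero => simp
  | succ n ih =>
    have := hf (k + n)
    rw [← add_assoc]
    push_cast
    linarith

/-- A sequence with gaps of at least `T` has at most `⌈(b - a) / T⌉` terms in `(a, b)`. -/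
lemma card_le_ceil_of_forall_add_le_succ {f : ℕ → ℝ} {T : ℝ} (hT : 0 < T)
    (hf : ∀ k, f k + T ≤ f (k + 1)) {a b : ℝ} {K : Finset ℕ} (hK : ∀ k ∈ K, a < f k ∧ f k < b) :
    K.card ≤ ⌈(b - a) / T⌉₊ := by
  rcases K.eq_empty_or_nonempty with rfl | hne
  · simp
  have hle : K.min' hne ≤ K.max' hne := K.min'_le _ (K.max'_mem hne)
  obtain ⟨n, hn⟩ := Nat.exists_eq_add_of_le hle
  have hcard : K.card ≤ n + 1 := by
    have : K ⊆ Finset.Icc (K.min' hne) (K.max' hne) := fun k hk =>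
      Finset.mem_Icc.2 ⟨K.min'_le _ hk, K.le_max' _ hk⟩
    have := Finset.card_le_card this
    rw [Nat.card_Icc] at this
    omega
  have h1 := add_mul_le_of_forall_add_le_succ hf (K.min' hne) n
  rw [← hn] at h1
  have h2 := (hK _ (K.min'_mem hne)).1
  have h3 := (hK _ (K.max'_mem hne)).2
  -- The interval is open, so the inequality is strict; this absorbs the `+ 1` between gaps and
  -- terms.
  have h4 : (n : ℝ) < (b - a) / T := by
    rw [lt_div_iff₀ hT]; linarith
  exact hcard.trans (Nat.lt_ceil.2 h4)

lemma finite_setOf_lt_of_forall_add_le_succ {f : ℕ → ℝ} {T : ℝ} (hT : 0 < T)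
    (hf : ∀ k, f k + T ≤ f (k + 1)) (b : ℝ) : {k | f k < b}.Finite := by
  obtain ⟨n, hn⟩ := exists_nat_gt ((b - f 0) / T)
  refine (Set.finite_Iio n).subset fun k hk => ?_
  have h1 := add_mul_le_of_forall_add_le_succ hf 0 k
  rw [zero_add] at h1
  have hk' : f k < b := hk
  have : (k : ℝ) < (b - f 0) / T := by
    rw [lt_div_iff₀ hT]; linarith
  exact Nat.cast_lt.1 (this.trans hn)

namespace Run

variable {ι : Type w} {Θ : Type v} {τ : ι → DAGTask.{u, v} Θ} {m : ℕ} [DecidableEq Θ]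
  {R : Run τ m} {P : ι → Finset (Fin m)} [Fintype Θ]

/-- If no job of task `j` is unfinished in `[r, d)` after its deadline, then the jobs of `j` hold
the lock of `q` in `[r, d)` for at most `⌈(d - r + D) / T⌉ * N * L` time units. -/
lemma Legal.volume_real_held_by_task_le (h : R.Legal P) (j : ι) (q : Θ) {r d : ℝ}
    (hdl : ∀ k a t, t ∈ Set.Ico r d → ¬ R.Done ⟨j, k, a⟩ t → t < R.release j k + (τ j).D) :
    (volume.restrict (Set.Ico r d)).real
        {t | t ∈ Set.Ico r d ∧ ∃ k a, R.holder q t = some ⟨j, k, a⟩} ≤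
      (⌈(d - r + (τ j).D) / (τ j).T⌉₊ : ℝ) * (τ j).N q * (τ j).L q := by
  have hfin : {k | r - (τ j).D < R.release j k ∧ R.release j k < d}.Finite :=
    (finite_setOf_lt_of_forall_add_le_succ (τ j).T_pos (h.release_sep j) d).subset
      fun k hk => hk.2
  have hcard : hfin.toFinset.card ≤ ⌈(d - r + (τ j).D) / (τ j).T⌉₊ := by
    have := card_le_ceil_of_forall_add_le_succ (τ j).T_pos (h.release_sep j)
      (K := hfin.toFinset) (fun k hk => hfin.mem_toFinset.1 hk)
    rwa [show d - (r - (τ j).D) = d - r + (τ j).D by ring] at this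
  have hsub : {t | t ∈ Set.Ico r d ∧ ∃ k a, R.holder q t = some ⟨j, k, a⟩} ⊆
      ⋃ k ∈ hfin.toFinset, {t | ∃ a, R.holder q t = some ⟨j, k, a⟩} := by
    rintro t ⟨ht, k, a, hk⟩
    simp only [Set.mem_iUnion]
    have hb := h.busy_eligible _ _ (h.holder_spec q t _ hk).1
    have h1 := hdl k a t ht hb.2
    -- A holder is eligible and unfinished, so its release is at most `t < d` and its deadline lies
    -- after `t ≥ r`.
    have h2 : R.release j k ≤ t := hb.1.1
    exact ⟨k, hfin.mem_toFinset.2 ⟨by linarith [ht.1], by linarith [ht.2]⟩, a, hk⟩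
  calc _ ≤ _ := measureReal_mono hsub (measure_ne_top _ _)
    _ ≤ _ := measureReal_biUnion_finset_le _ _
    _ ≤ _ := Finset.sum_le_sum fun k _ => h.volume_real_held_by_job_le j k q r d
    _ = (hfin.toFinset.card : ℝ) * ((τ j).N q * (τ j).L q) := by
      rw [Finset.sum_const, nsmul_eq_mul]
    _ ≤ _ := by
      rw [mul_assoc]
      exact mul_le_mul_of_nonneg_right (Nat.cast_le.2 hcard)
        (mul_nonneg (Nat.cast_nonneg _) ((τ j).L_nonneg q))

end Run

/-! ### Critical paths -/

namespace DAGTask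

variable {Θ : Type v} (τ : DAGTask.{u, v} Θ)

lemma wellFounded_transGen_edge : WellFounded (Relation.TransGen τ.edge) := by
  have : Std.Irrefl (Relation.TransGen τ.edge) := ⟨τ.acyclic⟩
  exact Finite.wellFounded_of_trans_of_irrefl _

lemma wellFounded_swap_transGen_edge :
    WellFounded (Function.swap (Relation.TransGen τ.edge)) := by
  have : Std.Irrefl (Function.swap (Relation.TransGen τ.edge)) := ⟨τ.acyclic⟩
  exact Finite.wellFounded_of_trans_of_irrefl _

lemma reflTransGen_tail (a : τ.V) : Relation.ReflTransGen τ.edge a τ.tail := by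
  induction a using τ.wellFounded_swap_transGen_edge.induction with
  | _ a ih =>
    by_cases ha : ∀ b, ¬ τ.edge a b
    · rw [(τ.tail_iff a).1 ha]
    · push Not at ha
      obtain ⟨b, hb⟩ := ha
      exact (ih b (Relation.TransGen.single hb)).head hb

variable {τ}

lemma nodup_of_isChain {π : List τ.V} (hπ : π.IsChain τ.edge) : π.Nodup := by
  have h1 : π.IsChain (Relation.TransGen τ.edge) := hπ.imp fun _ _ => Relation.TransGen.single
  refine List.Pairwise.imp ?_ (List.isChain_iff_pairwise.1 h1)
  rintro a _ hab rfl
  exact τ.acyclic a hab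

lemma exists_isChain_extend {π : List τ.V} (hπ : π.IsChain τ.edge)
    (hh : π.head? = some τ.head) {a b : τ.V} (ha : π.getLast? = some a)
    (hab : Relation.ReflTransGen τ.edge a b) :
    ∃ π' : List τ.V, π'.IsChain τ.edge ∧ π'.head? = some τ.head ∧ π'.getLast? = some b ∧
      π ⊆ π' := by
  induction hab with
  | refl => exact ⟨π, hπ, hh, ha, List.Subset.refl _⟩
  | @tail b c _ hbc ih =>
    obtain ⟨π', h1, h2, h3, h4⟩ := ih
    refine ⟨π' ++ [c], List.isChain_append.2 ⟨h1, List.isChain_singleton _, ?_⟩, ?_, ?_,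
      List.subset_append_of_subset_left _ h4⟩
    · intro x hx y hy
      rw [h3] at hx
      simp only [Option.mem_def, Option.some.injEq, List.head?_cons] at hx hy
      subst hx; subst hy
      exact hbc
    · simp [List.head?_append, h2]
    · simp

lemma len_eq_sum_toFinset [DecidableEq τ.V] {π : List τ.V} (hπ : π.IsChain τ.edge) :
    τ.len π = ∑ a ∈ π.toFinset, τ.wcet a :=
  (List.sum_toFinset _ (nodup_of_isChain hπ)).symm

lemma len_le_longest {π : List τ.V} (hπ : τ.IsCompletePath π) : τ.len π ≤ τ.longest := by
  classical
  refine le_csSup ⟨τ.totalWork, ?_⟩ ⟨π, hπ, rfl⟩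
  rintro _ ⟨π', hπ', rfl⟩
  rw [len_eq_sum_toFinset hπ'.1]
  exact Finset.sum_le_sum_of_subset_of_nonneg (Finset.subset_univ _)
    fun a _ _ => τ.wcet_nonneg a

/-- Let `U a` be the set of times at which `a` is unfinished. Some path from the head to `b`
contains, at each time at which `b` is unfinished, an unfinished vertex whose predecessors are all
finished. -/
lemma exists_critical_isChain {U : τ.V → Set ℝ} (hU : ∀ a, IsLowerSet (U a)) (b : τ.V) :
    ∃ π : List τ.V, π.IsChain τ.edge ∧ π.head? = some τ.head ∧ π.getLast? = some b ∧
      ∀ t ∈ U b, ∃ a ∈ π, t ∈ U a ∧ ∀ c, Relation.TransGen τ.edge c a → t ∉ U c := by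
  induction b using τ.wellFounded_transGen_edge.induction with
  | _ b ih =>
    by_cases hb : ∀ a, ¬ Relation.TransGen τ.edge a b
    · have := (τ.head_iff b).1 fun a hab => hb a (Relation.TransGen.single hab)
      refine ⟨[b], List.isChain_singleton _, by simp [this], by simp, fun t ht => ?_⟩
      exact ⟨b, by simp, ht, fun c hc => absurd hc (hb c)⟩
    · push Not at hb
      -- Lower sets of times are nested, so `a` is a predecessor, possibly indirect, that finishes
      -- last. Until then its own path serves; afterwards `b` is the witness.
      obtain ⟨a, hab, hmax⟩ := Set.Finite.exists_maximalFor U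
        {a | Relation.TransGen τ.edge a b} (Set.toFinite _) hb
      obtain ⟨π, h1, h2, h3, h4⟩ := ih a hab
      obtain ⟨π', h1', h2', h3', h4'⟩ := exists_isChain_extend h1 h2 h3 hab.to_reflTransGen
      refine ⟨π', h1', h2', h3', fun t ht => ?_⟩
      by_cases hta : t ∈ U a
      · obtain ⟨x, hx, hx'⟩ := h4 t hta
        exact ⟨x, h4' hx, hx'⟩
      · refine ⟨b, List.mem_of_getLast? h3', ht, fun c hc htc => hta ?_⟩
        rcases (hU a).total (hU c) with hac | hca
        · exact hmax hc hac htc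
        · exact hca htc

lemma exists_critical_path {U : τ.V → Set ℝ} (hU : ∀ a, IsLowerSet (U a)) (b : τ.V) :
    ∃ π : List τ.V, τ.IsCompletePath π ∧
      ∀ t ∈ U b, ∃ a ∈ π, t ∈ U a ∧ ∀ c, Relation.TransGen τ.edge c a → t ∉ U c := by
  obtain ⟨π, h1, h2, h3, h4⟩ := exists_critical_isChain hU b
  obtain ⟨π', h1', h2', h3', h4'⟩ := exists_isChain_extend h1 h2 h3 (τ.reflTransGen_tail b)
  refine ⟨π', ⟨h1', h2', h3'⟩, fun t ht => ?_⟩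
  obtain ⟨a, ha, ha'⟩ := h4 t ht
  exact ⟨a, h4' ha, ha'⟩

end DAGTask

/-! ### Work and processor counts -/

/-- If each point of `Z` lies in at least `M` of the sets `E a`, then `M` times the measure of `Z`
is at most the sum of the measures of the sets `E a ∩ Z`. -/
lemma mul_measureReal_le_sum_inter {α V : Type*} [MeasurableSpace α] [Fintype V] (μ : Measure α)
    [IsFiniteMeasure μ] {E : V → Set α} (hE : ∀ a, MeasurableSet (E a)) {Z : Set α}
    (hZ : MeasurableSet Z) (M : ℕ)
    (hM : ∀ t ∈ Z, ∃ s : Finset V, M ≤ s.card ∧ ∀ a ∈ s, t ∈ E a) :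
    M * μ.real Z ≤ ∑ a, μ.real (E a ∩ Z) := by
  have key : (M : ENNReal) * μ Z ≤ ∑ a, μ (E a ∩ Z) := by
    calc (M : ENNReal) * μ Z = ∫⁻ _ in Z, (M : ENNReal) ∂μ := (setLIntegral_const _ _).symm
      _ ≤ ∫⁻ t in Z, ∑ a, (E a).indicator 1 t ∂μ := by
        refine setLIntegral_mono' hZ fun t ht => ?_
        obtain ⟨s, hs, hsE⟩ := hM t ht
        calc (M : ENNReal) ≤ s.card := by exact_mod_cast hs
          _ = ∑ a ∈ s, (E a).indicator (1 : α → ENNReal) t := by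
            rw [Finset.sum_congr rfl fun a ha => Set.indicator_of_mem (hsE a ha) _]
            simp
          _ ≤ _ := Finset.sum_le_sum_of_subset (Finset.subset_univ s)
      _ = ∑ a, μ (E a ∩ Z) := by
        rw [lintegral_finsetSum _ fun a _ => measurable_one.indicator (hE a)]
        refine Finset.sum_congr rfl fun a _ => ?_
        rw [lintegral_indicator_one (hE a), Measure.restrict_apply (hE a)]
  have := ENNReal.toReal_mono (ENNReal.sum_ne_top.2 fun a _ => measure_ne_top _ _) key
  rwa [ENNReal.toReal_mul, ENNReal.toReal_natCast,
    ENNReal.toReal_sum fun a _ => measure_ne_top _ _] at this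

/-- Density above one gives C > D, and positive slack gives D > `longest` + `intraTerm`, so the
numerator is positive. -/
lemma one_le_procCount {ι : Type w} {Θ : Type v} [Fintype ι] [DecidableEq ι] [Fintype Θ]
    {τ : ι → DAGTask.{u, v} Θ} {i : ι} (hdens : 1 < (τ i).density) (hS : 0 < slack τ i) :
    1 ≤ procCount τ i := by
  have hC : (τ i).D < (τ i).totalWork := by
    rw [DAGTask.density, lt_div_iff₀ (τ i).D_pos, one_mul] at hdens
    exact hdens
  have hinter : 0 ≤ interTerm τ i :=
    Finset.sum_nonneg fun j _ => Finset.sum_nonneg fun q _ =>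
      mul_nonneg (mul_nonneg (Nat.cast_nonneg _) (Nat.cast_nonneg _)) ((τ j).L_nonneg q)
  refine Nat.ceil_pos.2 (div_pos ?_ hS)
  unfold slack at hS
  linarith

lemma le_procCount_mul_slack {ι : Type w} {Θ : Type v} [Fintype ι] [DecidableEq ι] [Fintype Θ]
    {τ : ι → DAGTask.{u, v} Θ} {i : ι} (hS : 0 < slack τ i) :
    (τ i).totalWork - ((τ i).longest + intraTerm τ i) ≤ procCount τ i * slack τ i :=
  (div_le_iff₀ hS).1 (Nat.le_ceil _)

/-! ### The earliest missed deadline -/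

namespace Run

variable {ι : Type w} {Θ : Type v} {τ : ι → DAGTask.{u, v} Θ} {m : ℕ}
  [DecidableEq Θ] {R : Run τ m} {P : ι → Finset (Fin m)}

lemma Legal.release_add_le (h : R.Legal P) (i : ι) {k k' : ℕ} (hk : k < k') :
    R.release i k + (τ i).T ≤ R.release i k' := by
  obtain ⟨n, rfl⟩ := Nat.exists_eq_add_of_lt hk
  have h1 := add_mul_le_of_forall_add_le_succ (h.release_sep i) k (n + 1)
  have h2 : (0 : ℝ) ≤ n * (τ i).T := mul_nonneg (Nat.cast_nonneg _) (τ i).T_pos.le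
  rw [← add_assoc] at h1
  push_cast at h1
  linarith

/-- Between release and deadline of a job, its task runs only this job if the earlier jobs of the
task have met their deadlines. -/
lemma Legal.eq_of_busy (h : R.Legal P) {i : ι} {k : ℕ}
    (hprev : ∀ k' < k, ∀ a, R.Done ⟨i, k', a⟩ (R.release i k' + (τ i).D)) {t : ℝ}
    (ht : t ∈ Set.Ico (R.release i k) (R.release i k + (τ i).D)) {x : JobVertex τ}
    (hx : x.task = i) (hb : R.Busy x t) : ∃ a, x = ⟨i, k, a⟩ := by
  obtain ⟨j, k', a⟩ := x
  change j = i at hx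
  subst hx
  have he := h.busy_eligible _ _ hb
  -- As D ≤ T, an earlier job is finished by the release of job `k`, and a later one is not released
  -- before its deadline.
  have hDT := (τ j).D_le_T
  rcases lt_trichotomy k' k with hk | hk | hk
  · have := h.release_add_le j hk
    exact absurd (h.done_mono (by linarith [ht.1]) (hprev k' hk a)) he.2
  · subst hk; exact ⟨a, rfl⟩
  · have := h.release_add_le j hk
    have h1 : R.release j k' ≤ t := he.1.1
    linarith [ht.2]

/-- The finish time is an infimum, so completion is known only just after the deadline; continuity
of progress carries it to the deadline itself. -/
lemma Legal.schedulable_iff (h : R.Legal P) (i : ι) :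
    R.Schedulable i ↔ ∀ k a, R.Done ⟨i, k, a⟩ (R.release i k + (τ i).D) := by
  rw [Schedulable, wcrt, iSup_le_iff]
  refine forall_congr' fun k => ?_
  have hiff : R.responseTime i k ≤ ((τ i).D : EReal) ↔
      R.finish i k ≤ ((R.release i k + (τ i).D : ℝ) : EReal) := by
    rw [responseTime, EReal.sub_le_iff_le_add (Or.inl (EReal.coe_ne_bot _))
      (Or.inl (EReal.coe_ne_top _)), EReal.coe_add, add_comm]
  rw [hiff]
  constructor
  · intro hle a
    have hgt : ∀ t, R.release i k + (τ i).D < t → R.exec ⟨i, k, a⟩ ≤ R.progress ⟨i, k, a⟩ t := by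
      intro t ht
      obtain ⟨_, ⟨s, hs, rfl⟩, hst⟩ := sInf_lt_iff.1 (hle.trans_lt (EReal.coe_lt_coe_iff.2 ht))
      exact h.done_mono (EReal.coe_lt_coe_iff.1 hst).le (hs.2 a)
    exact ge_of_tendsto
      ((h.continuous_progress ⟨i, k, a⟩).continuousAt.tendsto.mono_left nhdsWithin_le_nhds)
      (Filter.eventually_of_mem (self_mem_nhdsWithin (s := Set.Ioi _)) hgt)
  · intro hdone
    exact sInf_le ⟨_, ⟨by linarith [(τ i).D_pos], hdone⟩, rfl⟩

variable [Fintype Θ] [Fintype ι] [DecidableEq ι]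

/-- A job meets its deadline if all jobs with an earlier absolute deadline do. -/
lemma Legal.done_deadline (h : R.Legal P) (hP : Pairwise (fun i j => Disjoint (P i) (P j)))
    {i : ι} (hdens : 1 < (τ i).density) (hS : 0 < slack τ i) (hcard : (P i).card = procCount τ i)
    (k : ℕ)
    (hearlier : ∀ j k', R.release j k' + (τ j).D < R.release i k + (τ i).D →
      ∀ a, R.Done ⟨j, k', a⟩ (R.release j k' + (τ j).D)) (b : (τ i).V) :
    R.Done ⟨i, k, b⟩ (R.release i k + (τ i).D) := by
  classical
  by_contra hb
  set r := R.release i k with hr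
  set d := r + (τ i).D with hd
  have hDpos := (τ i).D_pos
  have hrd : r ≤ d := by linarith
  set μ := volume.restrict (Set.Ico r d) with hμ
  have hprev : ∀ k' < k, ∀ a, R.Done ⟨i, k', a⟩ (R.release i k' + (τ i).D) := fun k' hk' =>
    hearlier i k' (by have := h.release_add_le i hk'; have := (τ i).T_pos; linarith)
  have hmem : ∀ {q}, q ∈ (τ i).resources ↔ (τ i).Accesses q := by
    intro q; simp [DAGTask.resources]
  let E : (τ i).V → Set ℝ := fun a => {t | R.Executing ⟨i, k, a⟩ t}
  have hE : ∀ a, MeasurableSet (E a) := fun a => h.measurableSet_executing _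
  have hEprog : ∀ a, μ.real (E a) = R.progress ⟨i, k, a⟩ d := by
    intro a
    have h0 := h.progress_release ⟨i, k, a⟩
    rw [measureReal_restrict_apply (hE a), h.volume_real_executing_Ico _ hrd]
    change R.progress ⟨i, k, a⟩ r = 0 at h0
    rw [h0, sub_zero]
  have hprogw : ∀ a, R.progress ⟨i, k, a⟩ d ≤ (τ i).wcet a := fun a =>
    (h.progress_le_exec _ _).trans (h.exec_le_wcet ⟨i, k, a⟩)
  -- times at which another task holds a lock that concerns task `i`
  let B : Set ℝ := ⋃ j ∈ Finset.univ.erase i, ⋃ q ∈ (τ i).resources,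
    {t | t ∈ Set.Ico r d ∧ ∃ k' a, R.holder q t = some ⟨j, k', a⟩}
  have hBmeas : MeasurableSet B := by
    refine Finset.measurableSet_biUnion _ fun j _ => Finset.measurableSet_biUnion _ fun q _ => ?_
    refine measurableSet_Ico.inter ?_
    change MeasurableSet {t | ∃ k' a, R.holder q t = some ⟨j, k', a⟩}
    simp only [Set.ofPred_exists]
    exact MeasurableSet.iUnion fun k' => MeasurableSet.iUnion fun a => h.measurable_holder q _
  have hBle : μ.real B ≤ interTerm τ i := by
    refine (measureReal_biUnion_finset_le _ _).trans (Finset.sum_le_sum fun j _ => ?_)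
    refine (measureReal_biUnion_finset_le _ _).trans (Finset.sum_le_sum fun q hq => ?_)
    by_cases hjq : (τ j).Accesses q
    · refine (h.volume_real_held_by_task_le j q fun k' a t ht hnd => ?_).trans (le_of_eq ?_)
      · by_contra! hle
        exact hnd (h.done_mono hle (hearlier j k' (hle.trans_lt ht.2) a))
      · rw [eta, if_pos ⟨hmem.1 hq, hjq⟩, hd, add_sub_cancel_left]
    · have hN : (τ j).N q = 0 := Nat.eq_zero_of_not_pos hjq
      have hempty : {t | t ∈ Set.Ico r d ∧ ∃ k' a, R.holder q t = some ⟨j, k', a⟩} = ∅ := by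
        refine Set.eq_empty_of_forall_notMem ?_
        rintro t ⟨-, k', a, ha⟩
        obtain ⟨-, s, hs, rfl⟩ := h.holder_spec q t _ ha
        exact hjq (h.accesses_of_mem_sections hs.1)
      rw [hempty, measureReal_empty, hN]
      simp
  -- times at which the job itself holds a lock
  let W : Set ℝ := ⋃ q ∈ (τ i).resources, {t | ∃ a, R.holder q t = some ⟨i, k, a⟩}
  have hWmeas : MeasurableSet W := by
    refine Finset.measurableSet_biUnion _ fun q _ => ?_
    simp only [Set.ofPred_exists]
    exact MeasurableSet.iUnion fun a => h.measurable_holder q _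
  have hWle : μ.real W ≤ intraTerm τ i :=
    (measureReal_biUnion_finset_le _ _).trans
      (Finset.sum_le_sum fun q _ => h.volume_real_held_by_job_le i k q r d)
  -- times at which a vertex of a critical path executes
  obtain ⟨π, hπ, hcrit⟩ := DAGTask.exists_critical_path
    (U := fun a => {t | ¬ R.Done ⟨i, k, a⟩ t})
    (fun a t t' htt ht hd' => ht (h.done_mono htt hd')) b
  let X : Set ℝ := ⋃ a ∈ π.toFinset, E a
  have hXmeas : MeasurableSet X := Finset.measurableSet_biUnion _ fun a _ => hE a
  have hXle : μ.real X ≤ (τ i).longest := by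
    refine (measureReal_biUnion_finset_le _ _).trans (le_trans ?_ (DAGTask.len_le_longest hπ))
    rw [DAGTask.len_eq_sum_toFinset hπ.1]
    exact Finset.sum_le_sum fun a _ => (hEprog a).trans_le (hprogw a)
  -- outside `B` and `W` no vertex of the job spins
  have hexec : ∀ t ∈ Set.Ico r d, t ∉ B → t ∉ W → ∀ a, R.Busy ⟨i, k, a⟩ t → t ∈ E a := by
    intro t ht htB htW a ha
    refine ⟨ha, fun q hq => ?_⟩
    obtain ⟨y, hy⟩ := Option.ne_none_iff_exists'.1 (h.spin_held _ q t hq)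
    obtain ⟨-, ⟨s, hs, hsq⟩, -⟩ := hq
    have hqi : q ∈ (τ i).resources := hmem.2 (hsq ▸ h.accesses_of_mem_sections hs.1)
    by_cases hyi : y.task = i
    · obtain ⟨c, rfl⟩ := h.eq_of_busy hprev ht hyi (h.holder_spec q t y hy).1
      exact htW (Set.mem_biUnion hqi ⟨c, hy⟩)
    · exact htB (Set.mem_biUnion (Finset.mem_erase.2 ⟨hyi, Finset.mem_univ _⟩)
        (Set.mem_biUnion hqi ⟨ht, y.job, y.vertex, hy⟩))
  let Y : Set ℝ := (W ∪ X) \ B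
  let Z : Set ℝ := Set.Ico r d \ (B ∪ (W ∪ X))
  have hYmeas : MeasurableSet Y := (hWmeas.union hXmeas).diff hBmeas
  have hZmeas : MeasurableSet Z := measurableSet_Ico.diff (hBmeas.union (hWmeas.union hXmeas))
  have hYle : μ.real Y ≤ intraTerm τ i + (τ i).longest :=
    (measureReal_mono Set.sdiff_subset (measure_ne_top _ _)).trans
      ((measureReal_union_le _ _).trans (add_le_add hWle hXle))
  have hYE : ∀ t ∈ Y, ∃ s : Finset (τ i).V, 1 ≤ s.card ∧ ∀ a ∈ s, t ∈ E a := by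
    rintro t ⟨ht | ht, -⟩
    · simp only [W, Set.mem_iUnion] at ht
      obtain ⟨q, -, a, ha⟩ := ht
      exact ⟨{a}, by simp, fun c hc => by
        rw [Finset.mem_singleton.1 hc]; exact h.executing_of_holder ha⟩
    · simp only [X, Set.mem_iUnion] at ht
      obtain ⟨a, -, ha⟩ := ht
      exact ⟨{a}, by simp, fun c hc => by rw [Finset.mem_singleton.1 hc]; exact ha⟩
  have hZE : ∀ t ∈ Z, ∃ s : Finset (τ i).V, procCount τ i ≤ s.card ∧ ∀ a ∈ s, t ∈ E a := by
    rintro t ⟨ht, hnot⟩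
    simp only [Set.mem_union, not_or] at hnot
    obtain ⟨htB, htW, htX⟩ := hnot
    -- This vertex is eligible and unfinished. Were it busy, it would execute, as nothing spins
    -- outside `B` and `W`, which puts `t` in `X`. So it waits and no processor of `P i` is idle.
    obtain ⟨a, haπ, hnd, hanc⟩ := hcrit t fun hd' => hb (h.done_mono ht.2.le hd')
    have hel : R.Eligible ⟨i, k, a⟩ t := ⟨ht.1, fun c hc => not_not.1 (hanc c hc)⟩
    have hnb : ¬ R.Busy ⟨i, k, a⟩ t := fun hbusy =>
      htX (Set.mem_biUnion (List.mem_toFinset.2 haπ) (hexec t ht htB htW a hbusy))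
    have hall : ∀ p : P i, ∃ c, R.proc p t = some ⟨i, k, c⟩ := by
      rintro ⟨p, hp⟩
      obtain ⟨y, hy⟩ := Option.ne_none_iff_exists'.1 (h.work_conserving _ t hel hnd hnb p hp)
      have hyi : y.task = i := by
        by_contra hne
        exact Finset.disjoint_left.1 (hP hne) (h.proc_mem p t y hy) hp
      obtain ⟨c, rfl⟩ := h.eq_of_busy hprev ht hyi ⟨p, hy⟩
      exact ⟨c, hy⟩
    choose f hf using hall
    have hinj : Function.Injective f := fun p p' hpp =>
      Subtype.ext (h.proc_inj _ _ t _ (hf p) (hpp ▸ hf p'))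
    refine ⟨Finset.univ.image f, ?_, fun c hc => ?_⟩
    · rw [Finset.card_image_of_injective _ hinj, Finset.card_univ, Fintype.card_coe, hcard]
    · obtain ⟨p, -, rfl⟩ := Finset.mem_image.1 hc
      exact hexec t ht htB htW _ ⟨p, hf p⟩
  have hYwork := mul_measureReal_le_sum_inter μ hE hYmeas 1 hYE
  have hZwork := mul_measureReal_le_sum_inter μ hE hZmeas _ hZE
  have hsplit : ∀ a, μ.real (E a ∩ Y) + μ.real (E a ∩ Z) ≤ R.progress ⟨i, k, a⟩ d := by
    intro a
    rw [← hEprog a, ← measureReal_union ?_ ((hE a).inter hZmeas)]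
    · exact measureReal_mono (Set.union_subset Set.inter_subset_left Set.inter_subset_left)
        (measure_ne_top _ _)
    · exact Set.disjoint_left.2 fun t hY hZ => hZ.2.2 (Or.inr hY.2.1)
  have hwork : μ.real Y + procCount τ i * μ.real Z < (τ i).totalWork := by
    calc _ ≤ ∑ a, (μ.real (E a ∩ Y) + μ.real (E a ∩ Z)) := by
          rw [Finset.sum_add_distrib]
          push_cast at hYwork
          linarith
      _ ≤ ∑ a, R.progress ⟨i, k, a⟩ d := Finset.sum_le_sum fun a _ => hsplit a
      _ < ∑ a, (τ i).wcet a := Finset.sum_lt_sum (fun a _ => hprogw a)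
          ⟨b, Finset.mem_univ _, (not_le.1 hb).trans_le (h.exec_le_wcet ⟨i, k, b⟩)⟩
  have hcover : (τ i).D ≤ μ.real B + (μ.real Y + μ.real Z) := by
    have hI : μ.real (Set.Ico r d) = (τ i).D := by
      rw [measureReal_restrict_apply measurableSet_Ico, Set.inter_self,
        Real.volume_real_Ico_of_le hrd, hd, add_sub_cancel_left]
    have hsub : Set.Ico r d ⊆ B ∪ (Y ∪ Z) := by
      intro t ht
      by_cases hB : t ∈ B
      · exact Or.inl hB
      · by_cases hWX : t ∈ W ∪ X
        · exact Or.inr (Or.inl ⟨hWX, hB⟩)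
        · exact Or.inr (Or.inr ⟨ht, fun hc => hc.elim hB hWX⟩)
    calc (τ i).D = μ.real (Set.Ico r d) := hI.symm
      _ ≤ μ.real (B ∪ (Y ∪ Z)) := measureReal_mono hsub (measure_ne_top _ _)
      _ ≤ μ.real B + μ.real (Y ∪ Z) := measureReal_union_le _ _
      _ ≤ _ := by gcongr; exact measureReal_union_le _ _
  have hM : (1 : ℝ) ≤ procCount τ i := by exact_mod_cast one_le_procCount hdens hS
  have hCS := le_procCount_mul_slack hS
  have hz : slack τ i + (intraTerm τ i + (τ i).longest - μ.real Y) ≤ μ.real Z := by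
    unfold slack; linarith
  -- Time missing from `Y` relative to its bound moves to `Z`, where it counts `procCount` ≥ 1
  -- times, so the worst case is `Y` at its bound.
  have hmul := mul_le_mul_of_nonneg_left hz (zero_le_one.trans hM)
  have hmul' := mul_le_mul_of_nonneg_right hM (sub_nonneg.2 hYle)
  rw [mul_add] at hmul
  linarith

/-- Every task is schedulable if each task is known to be schedulable or is given processors by
the partitioning rule. -/
lemma Legal.schedulable_of_procCount (h : R.Legal P)
    (hP : Pairwise (fun i j => Disjoint (P i) (P j))) (hdens : ∀ i, 1 < (τ i).density)
    (hrule : ∀ j, R.Schedulable j ∨ (0 < slack τ j ∧ (P j).card = procCount τ j)) (i : ι) :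
    R.Schedulable i := by
  let deadline : ι × ℕ → ℝ := fun x => R.release x.1 x.2 + (τ x.1).D
  let missed : Set (ι × ℕ) := {x | ¬ ∀ a, R.Done ⟨x.1, x.2, a⟩ (deadline x)}
  suffices hmissed : missed = ∅ by
    rw [h.schedulable_iff]
    intro k
    by_contra hk
    exact (hmissed ▸ (show (i, k) ∈ missed from hk) : (i, k) ∈ (∅ : Set (ι × ℕ)))
  by_contra hne
  obtain ⟨x₀, hx₀⟩ := Set.nonempty_iff_ne_empty.2 hne
  -- Finitely many tasks with separated releases have finitely many jobs with bounded deadlines, so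
  -- an earliest missed deadline exists.
  have hfin : (missed ∩ {x | deadline x ≤ deadline x₀}).Finite := by
    refine (Set.finite_iUnion fun j => (finite_setOf_lt_of_forall_add_le_succ (τ j).T_pos
      (h.release_sep j) (deadline x₀)).image (Prod.mk j)).subset ?_
    rintro ⟨j, k⟩ ⟨-, hle⟩
    have hle' : R.release j k + (τ j).D ≤ deadline x₀ := hle
    have hlt : R.release j k < deadline x₀ := by linarith [(τ j).D_pos]
    exact Set.mem_iUnion.2 ⟨j, k, hlt, rfl⟩
  obtain ⟨⟨j, k⟩, ⟨hx, hxle⟩, hmin⟩ := Set.exists_min_image _ deadline hfin ⟨x₀, hx₀, le_refl (deadline x₀)⟩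
  rcases hrule j with hj | ⟨hS, hcard⟩
  · exact hx ((h.schedulable_iff j).1 hj k)
  · refine hx (h.done_deadline hP (hdens j) hS hcard k fun j' k' hlt => ?_)
    by_contra hmiss
    exact absurd (hmin (j', k') ⟨hmiss, (le_of_lt hlt).trans hxle⟩) (not_le.2 hlt)

end Run

/-! ### The partitioning algorithm -/

lemma partitionAlg_eq_some_iff {ι : Type w} {Θ : Type v} [Fintype ι] [DecidableEq ι] [Fintype Θ]
    (τ : ι → DAGTask.{u, v} Θ) {ts : List ι} (hts : ts.Nodup) (avail : ℕ) (A₀ A : ι → ℕ) :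
    partitionAlg τ ts avail A₀ = some A ↔
      (∀ i ∈ ts, 0 < slack τ i) ∧ (ts.map (procCount τ)).sum ≤ avail ∧
        A = fun i => if i ∈ ts then procCount τ i else A₀ i := by
  induction ts generalizing avail A₀ with
  | nil => simp [partitionAlg, eq_comm]
  | cons i ts ih =>
    obtain ⟨hi, hts⟩ := List.nodup_cons.1 hts
    have hfun : (fun j => if j ∈ ts then procCount τ j else
        Function.update A₀ i (procCount τ i) j) =
        fun j => if j ∈ i :: ts then procCount τ j else A₀ j := by
      funext j
      rcases eq_or_ne j i with rfl | hj
      · simp [hi]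
      · simp [hj]
    rw [partitionAlg]
    split_ifs with hS hav
    · simp only [List.map_cons, List.sum_cons, false_iff]
      rintro ⟨-, h, -⟩
      omega
    · rw [ih hts, hfun]
      simp only [List.forall_mem_cons, List.map_cons, List.sum_cons, hS, true_and]
      -- Truncated subtraction is harmless because `hav` ensures enough processors.
      rw [show (ts.map (procCount τ)).sum ≤ avail - procCount τ i ↔
        procCount τ i + (ts.map (procCount τ)).sum ≤ avail by omega]
    · simp only [false_iff]
      rintro ⟨h, -, -⟩
      exact hS (h i List.mem_cons_self)

lemma partitionAlg_eq_some_iff_of_forall_mem {ι : Type w} {Θ : Type v} [Fintype ι]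
    [DecidableEq ι] [Fintype Θ] (τ : ι → DAGTask.{u, v} Θ) {ts : List ι} (hts : ts.Nodup)
    (hall : ∀ i, i ∈ ts) (m : ℕ) (A₀ A : ι → ℕ) :
    partitionAlg τ ts m A₀ = some A ↔
      (∀ i, 0 < slack τ i) ∧ ∑ i, procCount τ i ≤ m ∧ A = procCount τ := by
  have hsum : (ts.map (procCount τ)).sum = ∑ i, procCount τ i := by
    rw [← List.sum_toFinset _ hts]
    congr 1
    ext i
    simp [hall i]
  rw [partitionAlg_eq_some_iff τ hts, hsum]
  simp [hall]

/-- Pairwise disjoint sets of processors with given cardinalities exist if there are enough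
processors. -/
lemma exists_pairwise_disjoint_card_eq {ι : Type w} [Fintype ι] {m : ℕ} {A : ι → ℕ}
    (hA : ∑ i, A i ≤ m) :
    ∃ P : ι → Finset (Fin m), Pairwise (fun i j => Disjoint (P i) (P j)) ∧
      ∀ i, (P i).card = A i := by
  -- Embed the disjoint union of blocks of sizes `A i` into the processors; the images of the blocks
  -- are the sets.
  obtain ⟨e⟩ : Nonempty ((Σ i, Fin (A i)) ↪ Fin m) :=
    Function.Embedding.nonempty_of_card_le (by simpa using hA)
  refine ⟨fun i => Finset.univ.map ((Function.Embedding.sigmaMk i).trans e), ?_, by simp⟩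
  intro i j hij
  refine Finset.disjoint_left.2 fun p hp hp' => hij ?_
  simp only [Finset.mem_map, Finset.mem_univ, true_and, Function.Embedding.trans_apply] at hp hp'
  obtain ⟨x, rfl⟩ := hp
  obtain ⟨y, hy⟩ := hp'
  exact congrArg Sigma.fst (e.injective hy).symm

theorem mainTheorem5 {ι : Type*} {Θ : Type*} [Fintype ι] [DecidableEq ι] [Fintype Θ]
    [DecidableEq Θ] (τ : ι → DAGTask Θ) (hdens : ∀ i, 1 < (τ i).density) (m : ℕ) :
    -- a task with positive slack is schedulable on `m_i` processors, in every run in which each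
    -- other task is schedulable or is itself given processors by the same rule
    (∀ P : ι → Finset (Fin m), Pairwise (fun i j => Disjoint (P i) (P j)) →
      ∀ R : Run τ m, R.Legal P →
        ∀ i, 0 < slack τ i → (P i).card = procCount τ i →
          (∀ j, j ≠ i → R.Schedulable j ∨ (0 < slack τ j ∧ (P j).card = procCount τ j)) →
          R.Schedulable i) ∧
    -- the algorithm succeeds exactly if each task has positive slack and can get `m_i` processors
    (∀ ts : List ι, ts.Nodup → (∀ i, i ∈ ts) → ∀ A : ι → ℕ,
      partitionAlg τ ts m (fun _ => 0) = some A ↔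
        (∀ i, 0 < slack τ i) ∧ ∑ i, procCount τ i ≤ m ∧ A = procCount τ) ∧
    -- and then its answer can be realized and makes the whole system schedulable
    (∀ ts : List ι, ts.Nodup → (∀ i, i ∈ ts) → ∀ A : ι → ℕ,
      partitionAlg τ ts m (fun _ => 0) = some A →
        (∃ P : ι → Finset (Fin m), Pairwise (fun i j => Disjoint (P i) (P j)) ∧
          ∀ i, (P i).card = A i) ∧
        ∀ P : ι → Finset (Fin m), Pairwise (fun i j => Disjoint (P i) (P j)) →
          (∀ i, (P i).card = A i) →
          ∀ R : Run τ m, R.Legal P → ∀ i, R.Schedulable i) := by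
  refine ⟨fun P hP R hR i hS hcard hrule => ?_,
    fun ts hts hall A => partitionAlg_eq_some_iff_of_forall_mem τ hts hall m _ A,
    fun ts hts hall A hA => ?_⟩
  · refine hR.schedulable_of_procCount hP hdens (fun j => ?_) i
    rcases eq_or_ne j i with rfl | hj
    · exact Or.inr ⟨hS, hcard⟩
    · exact hrule j hj
  · obtain ⟨hS, hm, rfl⟩ := (partitionAlg_eq_some_iff_of_forall_mem τ hts hall m _ A).1 hA
    exact ⟨exists_pairwise_disjoint_card_eq hm, fun P hP hcard R hR =>
      hR.schedulable_of_procCount hP hdens fun j => Or.inr ⟨hS j, hcard j⟩⟩
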